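/- For every integer $n \ge 0$, the $\mathrm{SA}'_+$-rank of $MT(K_{2n+1})$ is at most $n - \left\lfloor \frac{\sqrt{2n+1}-1}{2} \right\rfloor$. Here, for a graph $G=(V,E)$, $MT(G)$ is the set of all $x \in [0,1]^E$ such that, for every vertex $v$, the sum of $x_e$ over the edges $e$ incident with $v$ is at most $1$. For a finite index set $I$ let $F=\{0,1\}^I$. For $P \subseteq [0,1]^I$ let $P_I=\mathrm{conv}(P\cap F)$ be its integer hull and $K(P)=\{(\lambda,\lambda x): \lambda\ge 0,\ x\in P\}$. For $S \subseteq I$ and $t\in\{0,1\}$ put $S|_t=\{x\in F: x_i=t \text{ for all } i\in S\}$, write $i|_t$ for $\{i\}|_t$, and let $\mathcal A_k$ be the family of all sets $S|_1\cap T|_0$ with $S,T\subseteq I$ disjoint and $|S|+|T|\le k$. For $k\ge 1$, $\mathrm{SA}'^{k}_+(P)$ is the set of all $x\in\mathbb R^I$ for which there is a symmetric positive semidefinite real matrix $Y$, with rows and columns indexed by $\mathcal A_k$, such that 1. $Y[F,F]=1$ and $Y[i|_1,F]=x_i$ for all $i\in I$; 2. for every $\alpha\in\mathcal A_k$, $\bigl(Y[F,\alpha],(Y[i|_1,\alpha])_{i\in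 I}\bigr)\in K(P)$ and all entries of the column of $Y$ indexed by $\alpha$ are nonnegative; 3. for all disjoint $S,T\subseteq I$ with $|S|+|T|\le k-1$ and all $j\in I\setminus(S\cup T)$, the columns of $Y$ indexed by $S|_1\cap T|_0\cap j|_1$ and $S|_1\cap T|_0\cap j|_0$ sum to the column indexed by $S|_1\cap T|_0$; 4. $Y[\alpha,\beta]=0$ whenever $\alpha,\beta\in\mathcal A_k$ and $\alpha\cap\beta=\emptyset$ or $\mathrm{conv}(\alpha)\cap\mathrm{conv}(\beta)\cap P=\emptyset$; 5. $Y[\alpha_1,\beta_1]=Y[\alpha_2,\beta_2]$ whenever $\alpha_1,\beta_1,\alpha_2,\beta_2\in\mathcal A_k$ and $\alpha_1\cap\beta_1=\alpha_2\cap\beta_2$. Moreover $\mathrm{SA}'^{0}_+(P)=P$. The $\mathrm{SA}'_+$-rank of $P$ is the smallest integer $k\ge 0$ with $\mathrm{SA}'^{k}_+(P)=P_I$. -/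

import Mathlib

/-! ### Polytopes, integer hulls and ranks

Coordinates are indexed by a finite type `ι` (instead of `{1, …, n}`). -/

/-- The set `F = {0,1}^ι`, viewed inside `ℝ^ι`. -/
def cubePoints (ι : Type*) : Set (ι → ℝ) :=
  {x | ∀ i, x i = 0 ∨ x i = 1}

/-- The integer hull `P_I = conv (P ∩ {0,1}^ι)`. -/
def integerHull {ι : Type*} (P : Set (ι → ℝ)) : Set (ι → ℝ) :=
  convexHull ℝ (P ∩ cubePoints ι)

/-- The cone `K(P) = {(λ, λ x) : λ ≥ 0, x ∈ P}`; the first component is the coordinate `0`. -/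
def homCone {ι : Type*} (P : Set (ι → ℝ)) : Set (ℝ × (ι → ℝ)) :=
  {z | ∃ (c : ℝ) (x : ι → ℝ), 0 ≤ c ∧ x ∈ P ∧ z = (c, c • x)}

/-- `r` is the `Γ`-rank of `P`: the smallest integer `k` with `Γ^k(P) = P_I`. -/
def IsLiftRank {ι : Type*} (Γ : ℕ → Set (ι → ℝ) → Set (ι → ℝ)) (P : Set (ι → ℝ)) (r : ℕ) : Prop :=
  IsLeast {k : ℕ | Γ k P = integerHull P} r

/-! ### The index sets `A_k` -/

/-- `S|_t = {x ∈ F : x i = t for all i ∈ S}`. -/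
def cubeFace {ι : Type*} (S : Finset ι) (t : ℝ) : Set (ι → ℝ) :=
  {x ∈ cubePoints ι | ∀ i ∈ S, x i = t}

/-- `A_k`: all sets `S|_1 ∩ T|_0` with `S`, `T` disjoint and `|S| + |T| ≤ k`. -/
def faceFamily (ι : Type*) (k : ℕ) : Set (Set (ι → ℝ)) :=
  {α | ∃ S T : Finset ι, Disjoint S T ∧ S.card + T.card ≤ k ∧ α = cubeFace S 1 ∩ cubeFace T 0}

theorem cubePoints_mem_faceFamily (ι : Type*) (k : ℕ) : cubePoints ι ∈ faceFamily ι k :=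
  ⟨∅, ∅, by simp, by simp, by ext x; simp [cubeFace]⟩

theorem cubeFace_singleton_mem_faceFamily {ι : Type*} {k : ℕ} (hk : 1 ≤ k) (i : ι) :
    cubeFace {i} 1 ∈ faceFamily ι k :=
  ⟨{i}, ∅, by simp, by simpa using hk, by ext x; simp +contextual [cubeFace]⟩

theorem inter_mem_faceFamily {ι : Type*} {k : ℕ} {S T : Finset ι}
    (hd : Disjoint S T) (hc : S.card + T.card + 1 ≤ k) :
    cubeFace S 1 ∩ cubeFace T 0 ∈ faceFamily ι k :=
  ⟨S, T, hd, by omega, rfl⟩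

theorem inter_one_mem_faceFamily {ι : Type*} {k : ℕ} {S T : Finset ι}
    (hd : Disjoint S T) (hc : S.card + T.card + 1 ≤ k) {j : ι} (hS : j ∉ S) (hT : j ∉ T) :
    cubeFace S 1 ∩ cubeFace T 0 ∩ cubeFace {j} 1 ∈ faceFamily ι k := by
  classical
  refine ⟨insert j S, T, by simp [hd, hT], ?_, ?_⟩
  · rw [Finset.card_insert_of_notMem hS]; omega
  · ext x
    simp only [cubeFace, Set.mem_inter_iff, Set.mem_ofPred_eq, Finset.mem_insert,
      Finset.mem_singleton, forall_eq_or_imp, forall_eq]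
    tauto

theorem inter_zero_mem_faceFamily {ι : Type*} {k : ℕ} {S T : Finset ι}
    (hd : Disjoint S T) (hc : S.card + T.card + 1 ≤ k) {j : ι} (hS : j ∉ S) (hT : j ∉ T) :
    cubeFace S 1 ∩ cubeFace T 0 ∩ cubeFace {j} 0 ∈ faceFamily ι k := by
  classical
  refine ⟨S, insert j T, by simp [hd, hS], ?_, ?_⟩
  · rw [Finset.card_insert_of_notMem hT]; omega
  · ext x
    simp only [cubeFace, Set.mem_inter_iff, Set.mem_ofPred_eq, Finset.mem_insert,
      Finset.mem_singleton, forall_eq_or_imp, forall_eq]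
    tauto

/-! ### The operator `SA'_+` -/

/-- `x̂(y) = (y_F, (y_{i|_1})_i)` for a vector `y` indexed by `A_k`, `k ≥ 1`. -/
def hatVec {ι : Type*} {k : ℕ} (hk : 1 ≤ k) (y : faceFamily ι k → ℝ) : ℝ × (ι → ℝ) :=
  (y ⟨cubePoints ι, cubePoints_mem_faceFamily ι k⟩,
    fun i => y ⟨cubeFace {i} 1, cubeFace_singleton_mem_faceFamily hk i⟩)

/-- The lifted set of the operator `SA_+^k`, `k ≥ 1`: symmetric positive semidefinite matrices with
rows and columns indexed by `A_k`. The column of `Y` indexed by `α` is `fun γ => Y γ α`. -/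
structure IsSAPlusLift {ι : Type*} {k : ℕ} (hk : 1 ≤ k) (P : Set (ι → ℝ))
    (Y : Matrix (faceFamily ι k) (faceFamily ι k) ℝ) : Prop where
  posSemidef : Y.PosSemidef
  unit_entry : Y ⟨cubePoints ι, cubePoints_mem_faceFamily ι k⟩
    ⟨cubePoints ι, cubePoints_mem_faceFamily ι k⟩ = 1
  col_mem_cone : ∀ α, hatVec hk (fun γ => Y γ α) ∈ homCone P
  col_nonneg : ∀ α γ, 0 ≤ Y γ α
  col_partition : ∀ (S T : Finset ι) (hd : Disjoint S T) (hc : S.card + T.card + 1 ≤ k)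
    (j : ι) (hS : j ∉ S) (hT : j ∉ T) (γ : faceFamily ι k),
    Y γ ⟨cubeFace S 1 ∩ cubeFace T 0 ∩ cubeFace {j} 1, inter_one_mem_faceFamily hd hc hS hT⟩
      + Y γ ⟨cubeFace S 1 ∩ cubeFace T 0 ∩ cubeFace {j} 0, inter_zero_mem_faceFamily hd hc hS hT⟩
      = Y γ ⟨cubeFace S 1 ∩ cubeFace T 0, inter_mem_faceFamily hd hc⟩
  entry_eq_zero : ∀ α β : faceFamily ι k, (α : Set (ι → ℝ)) ∩ β = ∅ → Y α β = 0
  entry_congr : ∀ α₁ β₁ α₂ β₂ : faceFamily ι k,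
    (α₁ : Set (ι → ℝ)) ∩ β₁ = (α₂ : Set (ι → ℝ)) ∩ β₂ → Y α₁ β₁ = Y α₂ β₂

/-- The lifted set of the operator `SA'_+^k`, `k ≥ 1`: in addition, `Y[α, β] = 0` whenever
`conv α ∩ conv β ∩ P = ∅`. -/
structure IsSAPlusPrimeLift {ι : Type*} {k : ℕ} (hk : 1 ≤ k) (P : Set (ι → ℝ))
    (Y : Matrix (faceFamily ι k) (faceFamily ι k) ℝ) : Prop extends IsSAPlusLift hk P Y where
  entry_eq_zero_of_conv : ∀ α β : faceFamily ι k,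
    convexHull ℝ (α : Set (ι → ℝ)) ∩ convexHull ℝ (β : Set (ι → ℝ)) ∩ P = ∅ → Y α β = 0

/-- `SA'_+^k(P)`: all `x` such that `x̂(Y e_F) = (1, x)` for some `Y` in the lifted set. As usual,
zero rounds of the operator leave `P` unchanged. -/
def saPlusPrime {ι : Type*} (k : ℕ) (P : Set (ι → ℝ)) : Set (ι → ℝ) :=
  {x | (k = 0 ∧ x ∈ P) ∨
    ∃ hk : 1 ≤ k, ∃ Y : Matrix (faceFamily ι k) (faceFamily ι k) ℝ, IsSAPlusPrimeLift hk P Y ∧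
      hatVec hk (fun γ => Y γ ⟨cubePoints ι, cubePoints_mem_faceFamily ι k⟩) = (1, x)}

/-! ### The fractional matching polytope -/

/-- `MT(G)`: all `x ∈ [0,1]^E` such that, for every vertex `v`, the sum of `x e` over the edges `e`
incident with `v` is at most `1`. -/
def matchingRelaxation {V : Type*} [Fintype V] [DecidableEq V] (G : SimpleGraph V)
    [DecidableRel G.Adj] : Set (G.edgeSet → ℝ) :=
  {x | (∀ e, 0 ≤ x e ∧ x e ≤ 1) ∧
    ∀ v : V, ∑ e ∈ Finset.univ.filter (fun e : G.edgeSet => v ∈ (e : Sym2 V)), x e ≤ 1}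

/-! A general criterion (`saPlusPrime_eq_integerHull`) does the work: for a convex down-closed `P`
of nonnegative points, level `k ≥ 1` is exact once every feasible `S` with `|S| = k` has at most `k`
feasible one-element extensions. If a lifted `x` lay outside the hull, some `a ≥ 0` and `b` would
satisfy `a(M) < b < a·x` for all feasible `M`. Let `s(S)` be the slack of `a·x ≤ b` in the column of
`S|_1`. For `|S| = k`, conditioning on the possible extensions writes `s(S)` as a nonnegative
combination of slacks of feasible sets. Positive semidefiniteness then carries `s ≥ 0` down to `S =
∅`, where `s(∅) = b - a·x < 0`, a contradiction.

In `K_{2n+1}` a matching of size `n - g` misses `2g + 1` vertices, so it has at most `g(2g+1)`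
extensions. This is at most `n - g` iff `(2g+1)² ≤ 2n + 1`. -/

/-! ### Calculus of cube faces -/

section Faces

variable {ι : Type*}

/-- The face `S|_1 ∩ T|_0` of the cube. -/
def mixedFace (S T : Finset ι) : Set (ι → ℝ) := cubeFace S 1 ∩ cubeFace T 0

theorem mem_mixedFace {S T : Finset ι} {x : ι → ℝ} :
    x ∈ mixedFace S T ↔ x ∈ cubePoints ι ∧ (∀ i ∈ S, x i = 1) ∧ ∀ i ∈ T, x i = 0 := by
  simp only [mixedFace, cubeFace, Set.mem_inter_iff, Set.mem_ofPred_eq]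
  tauto

theorem mixedFace_empty : mixedFace (∅ : Finset ι) ∅ = cubePoints ι := by
  ext x; simp [mem_mixedFace]

theorem mixedFace_singleton (i : ι) : mixedFace {i} ∅ = cubeFace {i} 1 := by
  ext x; simp [mem_mixedFace, cubeFace]

theorem mixedFace_inter [DecidableEq ι] (S T S' T' : Finset ι) :
    mixedFace S T ∩ mixedFace S' T' = mixedFace (S ∪ S') (T ∪ T') := by
  ext x
  simp only [Set.mem_inter_iff, mem_mixedFace, Finset.mem_union, or_imp, forall_and]
  tauto

theorem mixedFace_inter_one [DecidableEq ι] (S T : Finset ι) (j : ι) :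
    mixedFace S T ∩ cubeFace {j} 1 = mixedFace (insert j S) T := by
  rw [← mixedFace_singleton, mixedFace_inter, Finset.union_comm, Finset.union_empty]; rfl

theorem mixedFace_inter_zero [DecidableEq ι] (S T : Finset ι) (j : ι) :
    mixedFace S T ∩ cubeFace {j} 0 = mixedFace S (insert j T) := by
  ext x
  simp only [mem_mixedFace, cubeFace, Set.mem_inter_iff, Set.mem_ofPred_eq, Finset.mem_insert,
    Finset.mem_singleton, forall_eq_or_imp, forall_eq]
  tauto

theorem mixedFace_mem_faceFamily {k : ℕ} {S T : Finset ι} (hd : Disjoint S T)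
    (hc : S.card + T.card ≤ k) : mixedFace S T ∈ faceFamily ι k :=
  ⟨S, T, hd, hc, rfl⟩

theorem eq_one_of_mem_convexHull_mixedFace {S T : Finset ι} {x : ι → ℝ}
    (hx : x ∈ convexHull ℝ (mixedFace S T)) {i : ι} (hi : i ∈ S) : x i = 1 := by
  have hconv : Convex ℝ {z : ι → ℝ | z i = 1} := by
    intro y hy z hz a b _ _ hab
    simp only [Set.mem_ofPred_eq] at hy hz ⊢
    simp [hy, hz, hab]
  exact convexHull_min (fun z hz => (mem_mixedFace.1 hz).2.1 i hi) hconv hx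

end Faces

/-! ### The homogenized cone -/

section Cone

variable {ι : Type*} {P : Set (ι → ℝ)}

theorem add_mem_homCone (hP : Convex ℝ P) {y z : ℝ × (ι → ℝ)} (hy : y ∈ homCone P)
    (hz : z ∈ homCone P) : y + z ∈ homCone P := by
  obtain ⟨c, x, hc, hx, rfl⟩ := hy
  obtain ⟨d, w, hd, hw, rfl⟩ := hz
  rcases (add_nonneg hc hd).eq_or_lt with h | h
  · obtain rfl : c = 0 := by linarith
    obtain rfl : d = 0 := by linarith
    exact ⟨0, x, le_rfl, hx, by simp⟩
  · refine ⟨c + d, (c / (c + d)) • x + (d / (c + d)) • w, h.le,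
      hP hx hw (by positivity) (by positivity) (by field_simp), ?_⟩
    rw [smul_add, smul_smul, smul_smul, mul_div_cancel₀ _ h.ne', mul_div_cancel₀ _ h.ne']
    simp

theorem smul_mem_homCone {y : ℝ × (ι → ℝ)} (hy : y ∈ homCone P) {a : ℝ} (ha : 0 ≤ a) :
    a • y ∈ homCone P := by
  obtain ⟨c, x, hc, hx, rfl⟩ := hy
  exact ⟨a * c, x, mul_nonneg ha hc, hx, by simp [smul_smul]⟩

end Cone

/-! ### The integer hull survives every round -/

section IntegralPoints

variable {ι : Type*} {P : Set (ι → ℝ)} {k : ℕ}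

theorem IsSAPlusPrimeLift.convexCombination (hP : Convex ℝ P) {hk : 1 ≤ k}
    {Y Z : Matrix (faceFamily ι k) (faceFamily ι k) ℝ} (hY : IsSAPlusPrimeLift hk P Y)
    (hZ : IsSAPlusPrimeLift hk P Z) {a b : ℝ} (ha : 0 ≤ a) (hb : 0 ≤ b) (hab : a + b = 1) :
    IsSAPlusPrimeLift hk P (a • Y + b • Z) where
  posSemidef := (hY.posSemidef.smul ha).add (hZ.posSemidef.smul hb)
  unit_entry := by simp [hY.unit_entry, hZ.unit_entry, hab]
  col_mem_cone α :=
    add_mem_homCone hP (smul_mem_homCone (hY.col_mem_cone α) ha)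
      (smul_mem_homCone (hZ.col_mem_cone α) hb)
  col_nonneg α γ :=
    add_nonneg (mul_nonneg ha (hY.col_nonneg α γ)) (mul_nonneg hb (hZ.col_nonneg α γ))
  col_partition S T hd hc j hS hT γ := by
    simp only [Matrix.add_apply, Matrix.smul_apply, smul_eq_mul]
    rw [← hY.col_partition S T hd hc j hS hT γ, ← hZ.col_partition S T hd hc j hS hT γ]
    ring
  entry_eq_zero α β h := by simp [hY.entry_eq_zero α β h, hZ.entry_eq_zero α β h]
  entry_congr α₁ β₁ α₂ β₂ h := by
    simp [hY.entry_congr α₁ β₁ α₂ β₂ h, hZ.entry_congr α₁ β₁ α₂ β₂ h]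
  entry_eq_zero_of_conv α β h := by
    simp [hY.entry_eq_zero_of_conv α β h, hZ.entry_eq_zero_of_conv α β h]

theorem convex_saPlusPrime (hP : Convex ℝ P) (hk : 1 ≤ k) : Convex ℝ (saPlusPrime k P) := by
  rintro x (⟨rfl, -⟩ | ⟨_, Y, hY, hx⟩) y hy a b ha hb hab
  · omega
  rcases hy with ⟨rfl, -⟩ | ⟨_, Z, hZ, hy⟩
  · omega
  refine Or.inr ⟨hk, a • Y + b • Z, hY.convexCombination hP hZ ha hb hab, ?_⟩
  have : hatVec hk (fun γ => (a • Y + b • Z) γ ⟨cubePoints ι, cubePoints_mem_faceFamily ι k⟩)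
      = a • hatVec hk (fun γ => Y γ ⟨cubePoints ι, cubePoints_mem_faceFamily ι k⟩)
        + b • hatVec hk (fun γ => Z γ ⟨cubePoints ι, cubePoints_mem_faceFamily ι k⟩) := rfl
  rw [this, hx, hy]
  simp [hab]

open Classical in
/-- The rank-one matrix recording which faces contain the point `x`. -/
noncomputable def incidenceLift (k : ℕ) (x : ι → ℝ) :
    Matrix (faceFamily ι k) (faceFamily ι k) ℝ :=
  fun α β => if x ∈ (α : Set (ι → ℝ)) ∩ β then 1 else 0

theorem incidenceLift_posSemidef (x : ι → ℝ) : (incidenceLift k x).PosSemidef := by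
  classical
  -- The matrix is a rank-one `2 × 2` matrix pulled back along the indicator of `x ∈ α`.
  have h := (Matrix.posSemidef_vecMulVec_self_star
    (fun b : Bool => if b then (1 : ℝ) else 0)).submatrix
    (fun α : faceFamily ι k => decide (x ∈ (α : Set (ι → ℝ))))
  convert h using 1
  ext α β
  by_cases hα : x ∈ (α : Set (ι → ℝ)) <;> by_cases hβ : x ∈ (β : Set (ι → ℝ)) <;>
    simp [incidenceLift, Matrix.vecMulVec_apply, hα, hβ]

theorem hatVec_incidenceLift (hk : 1 ≤ k) {x : ι → ℝ} (hx : x ∈ cubePoints ι)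
    {α : faceFamily ι k} (hα : x ∈ (α : Set (ι → ℝ))) :
    hatVec hk (fun γ => incidenceLift k x γ α) = (1, x) := by
  classical
  refine Prod.ext (by simp [hatVec, incidenceLift, hx, hα]) (funext fun i => ?_)
  have : (x ∈ cubeFace {i} 1) ↔ x i = 1 := by simp [cubeFace, hx]
  rcases hx i with h | h <;> simp [hatVec, incidenceLift, hα, this, h]

theorem isSAPlusPrimeLift_incidenceLift (hk : 1 ≤ k) {x : ι → ℝ} (hxP : x ∈ P)
    (hx : x ∈ cubePoints ι) : IsSAPlusPrimeLift hk P (incidenceLift k x) where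
  posSemidef := incidenceLift_posSemidef x
  unit_entry := by simp [incidenceLift, hx]
  col_mem_cone α := by
    classical
    by_cases hα : x ∈ (α : Set (ι → ℝ))
    · rw [hatVec_incidenceLift hk hx hα]
      exact ⟨1, x, zero_le_one, hxP, by simp⟩
    · exact ⟨0, x, le_rfl, hxP, by ext <;> simp [hatVec, incidenceLift, hα]⟩
  col_nonneg α γ := by unfold incidenceLift; split_ifs <;> simp
  col_partition S T hd hc j hS hT γ := by
    classical
    have h1 : (x ∈ cubeFace {j} 1) ↔ x j = 1 := by simp [cubeFace, hx]
    have h0 : (x ∈ cubeFace {j} 0) ↔ x j = 0 := by simp [cubeFace, hx]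
    rcases hx j with h | h <;> simp [incidenceLift, h1, h0, h]
  entry_eq_zero α β h := by simp [incidenceLift, h]
  entry_congr α₁ β₁ α₂ β₂ h := by
    classical
    exact if_congr (by rw [h]) rfl rfl
  entry_eq_zero_of_conv α β h := by
    refine if_neg fun hx => ?_
    have : x ∈ convexHull ℝ (α : Set (ι → ℝ)) ∩ convexHull ℝ (β : Set (ι → ℝ)) ∩ P :=
      ⟨⟨subset_convexHull ℝ _ hx.1, subset_convexHull ℝ _ hx.2⟩, hxP⟩
    rw [h] at this
    exact this

theorem integerHull_subset_saPlusPrime (hP : Convex ℝ P) (hk : 1 ≤ k) :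
    integerHull P ⊆ saPlusPrime k P :=
  convexHull_min (fun _ hx => Or.inr ⟨hk, _, isSAPlusPrimeLift_incidenceLift hk hx.1 hx.2,
    hatVec_incidenceLift hk hx.2 hx.2⟩) (convex_saPlusPrime hP hk)

end IntegralPoints

/-! ### Separation by nonnegative functionals -/

section Separation

variable {ι : Type*}

open Classical in
/-- The 0-1 point with support `S`. -/
noncomputable def charPoint (S : Finset ι) : ι → ℝ := fun i => if i ∈ S then 1 else 0

theorem charPoint_mem_cubePoints (S : Finset ι) : charPoint S ∈ cubePoints ι := by
  intro i; unfold charPoint; split_ifs <;> simp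

/-- Negative coefficients of a Hahn–Banach functional can be cut to `0`: this only raises its value
at `x ≥ 0`, and its new value on `M` is the old one on the subset of `M` with positive coefficients,
which is feasible by down-closedness. -/
theorem exists_nonneg_separation [Fintype ι] {P : Set (ι → ℝ)}
    (hdown : ∀ x ∈ P, ∀ y : ι → ℝ, 0 ≤ y → y ≤ x → y ∈ P)
    {x : ι → ℝ} (hx0 : 0 ≤ x) (hx : x ∉ integerHull P) :
    ∃ (a : ι → ℝ) (b : ℝ), 0 ≤ a ∧ b < ∑ i, a i * x i ∧
      ∀ M : Finset ι, charPoint M ∈ P → ∑ i ∈ M, a i < b := by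
  classical
  have hfin : (P ∩ cubePoints ι).Finite := by
    refine (Set.Finite.pi' (fun _ : ι => Set.toFinite ({0, 1} : Set ℝ))).subset ?_
    intro y hy i
    simpa using hy.2 i
  obtain ⟨f, u, hu, hux⟩ := geometric_hahn_banach_closed_point (convex_convexHull ℝ _)
    (hfin.isClosed_convexHull ℝ) hx
  set c : ι → ℝ := fun i => f (Pi.single i 1) with hc
  have hf : ∀ y : ι → ℝ, f y = ∑ i, c i * y i := by
    intro y
    conv_lhs => rw [← Finset.univ_sum_single y]
    rw [map_sum]
    refine Finset.sum_congr rfl fun i _ => ?_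
    have : (Pi.single i (y i) : ι → ℝ) = y i • Pi.single i 1 := by
      rw [← Pi.single_smul, smul_eq_mul, mul_one]
    rw [this, map_smul, smul_eq_mul, mul_comm]
  refine ⟨fun i => max (c i) 0, u, fun i => le_max_right _ _, ?_, fun M hM => ?_⟩
  · rw [hf] at hux
    exact hux.trans_le (Finset.sum_le_sum fun i _ =>
      mul_le_mul_of_nonneg_right (le_max_left _ _) (hx0 i))
  · have hM' : charPoint (M.filter fun i => 0 < c i) ∈ P := by
      refine hdown _ hM _ (fun i => ?_) (fun i => ?_)
      · unfold charPoint; simp only [Pi.zero_apply]; split_ifs <;> simp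
      · by_cases hi : i ∈ M <;> by_cases hi' : 0 < c i <;> simp [charPoint, hi, hi']
    have h := hu _ (subset_convexHull ℝ _ ⟨hM', charPoint_mem_cubePoints _⟩)
    rw [hf] at h
    convert h using 1
    simp only [charPoint, mul_ite, mul_one, mul_zero, Finset.sum_ite_mem, Finset.univ_inter]
    rw [Finset.sum_filter]
    refine Finset.sum_congr rfl fun i _ => ?_
    split_ifs with h
    · exact max_eq_left h.le
    · exact max_eq_right (not_lt.1 h)

end Separation

/-! ### Exactness from few extensions -/

section Exactness

variable {ι : Type*} {P : Set (ι → ℝ)} {k : ℕ}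

open Classical in
/-- The entry of `Y` at a pair of sets, and `0` unless both sets index rows of `Y`. -/
noncomputable def liftEntry (Y : Matrix (faceFamily ι k) (faceFamily ι k) ℝ)
    (α β : Set (ι → ℝ)) : ℝ :=
  if h : α ∈ faceFamily ι k ∧ β ∈ faceFamily ι k then Y ⟨α, h.1⟩ ⟨β, h.2⟩ else 0

theorem liftEntry_of_mem (Y : Matrix (faceFamily ι k) (faceFamily ι k) ℝ)
    {α β : Set (ι → ℝ)} (hα : α ∈ faceFamily ι k) (hβ : β ∈ faceFamily ι k) :
    liftEntry Y α β = Y ⟨α, hα⟩ ⟨β, hβ⟩ :=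
  dif_pos ⟨hα, hβ⟩

variable {hk : 1 ≤ k} {Y : Matrix (faceFamily ι k) (faceFamily ι k) ℝ}

theorem IsSAPlusLift.liftEntry_nonneg (hY : IsSAPlusLift hk P Y) (α β : Set (ι → ℝ)) :
    0 ≤ liftEntry Y α β := by
  unfold liftEntry
  split_ifs
  · exact hY.col_nonneg _ _
  · exact le_rfl

theorem IsSAPlusLift.liftEntry_congr (hY : IsSAPlusLift hk P Y) {α₁ β₁ α₂ β₂ : Set (ι → ℝ)}
    (hα₁ : α₁ ∈ faceFamily ι k) (hβ₁ : β₁ ∈ faceFamily ι k) (hα₂ : α₂ ∈ faceFamily ι k)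
    (hβ₂ : β₂ ∈ faceFamily ι k) (h : α₁ ∩ β₁ = α₂ ∩ β₂) :
    liftEntry Y α₁ β₁ = liftEntry Y α₂ β₂ := by
  rw [liftEntry_of_mem Y hα₁ hβ₁, liftEntry_of_mem Y hα₂ hβ₂]
  exact hY.entry_congr ⟨α₁, hα₁⟩ ⟨β₁, hβ₁⟩ ⟨α₂, hα₂⟩ ⟨β₂, hβ₂⟩ h

theorem IsSAPlusLift.liftEntry_partition [DecidableEq ι] (hY : IsSAPlusLift hk P Y)
    {γ : Set (ι → ℝ)} (hγ : γ ∈ faceFamily ι k) (R : Finset ι) :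
    ∀ S T : Finset ι, Disjoint S T → Disjoint R (S ∪ T) → S.card + T.card + R.card ≤ k →
      liftEntry Y γ (mixedFace S T) =
        ∑ N ∈ R.powerset, liftEntry Y γ (mixedFace (S ∪ N) (T ∪ R \ N)) := by
  induction R using Finset.induction_on with
  | empty => intro S T _ _ _; simp
  | insert j R hj ih =>
    intro S T hd hR hc
    rw [Finset.card_insert_of_notMem hj] at hc
    rw [Finset.disjoint_insert_left, Finset.mem_union, not_or] at hR
    obtain ⟨⟨hjS, hjT⟩, hR⟩ := hR
    rw [Finset.disjoint_union_right] at hR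
    have h1 : Disjoint (insert j S) T := by simp [hd, hjT]
    have h0 : Disjoint S (insert j T) := by simp [hd, hjS]
    have c1 : (insert j S).card + T.card ≤ k := by
      rw [Finset.card_insert_of_notMem hjS]; omega
    have c0 : S.card + (insert j T).card ≤ k := by
      rw [Finset.card_insert_of_notMem hjT]; omega
    have key : liftEntry Y γ (mixedFace S T) = liftEntry Y γ (mixedFace (insert j S) T)
        + liftEntry Y γ (mixedFace S (insert j T)) := by
      have := hY.col_partition S T hd (by omega) j hjS hjT ⟨γ, hγ⟩
      rw [liftEntry_of_mem Y hγ (mixedFace_mem_faceFamily hd (by omega)),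
        liftEntry_of_mem Y hγ (mixedFace_mem_faceFamily h1 c1),
        liftEntry_of_mem Y hγ (mixedFace_mem_faceFamily h0 c0)]
      simp only [← mixedFace_inter_one, ← mixedFace_inter_zero]
      exact this.symm
    rw [key, Finset.sum_powerset_insert hj, add_comm,
      ih (insert j S) T h1 (by simp [hj, hR]) (by rw [Finset.card_insert_of_notMem hjS]; omega),
      ih S (insert j T) h0 (by simp [hj, hR]) (by rw [Finset.card_insert_of_notMem hjT]; omega)]
    congr 1 <;> refine Finset.sum_congr rfl fun N hN => ?_
    · have hjN : j ∉ N := fun h => hj (Finset.mem_powerset.1 hN h)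
      rw [Finset.insert_sdiff_of_notMem _ hjN, Finset.union_insert, Finset.insert_union]
    · rw [Finset.insert_sdiff_insert, Finset.sdiff_insert_of_notMem hj, Finset.union_insert,
        Finset.insert_union]

/-- A point of `P` in both convex hulls equals `1` on `S ∪ S'`, so it dominates `charPoint (S ∪
S')`; down-closedness would make that point feasible. -/
theorem IsSAPlusPrimeLift.liftEntry_eq_zero [DecidableEq ι] (hY : IsSAPlusPrimeLift hk P Y)
    (hP0 : ∀ x ∈ P, 0 ≤ x) (hdown : ∀ x ∈ P, ∀ y : ι → ℝ, 0 ≤ y → y ≤ x → y ∈ P)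
    {S T S' T' : Finset ι} (h : charPoint (S ∪ S') ∉ P) :
    liftEntry Y (mixedFace S T) (mixedFace S' T') = 0 := by
  unfold liftEntry
  split_ifs with hm
  · refine hY.entry_eq_zero_of_conv _ _ (Set.eq_empty_iff_forall_notMem.2 ?_)
    rintro z ⟨⟨hz, hz'⟩, hzP⟩
    refine h (hdown z hzP _ (fun i => ?_) fun i => ?_)
    · unfold charPoint; simp only [Pi.zero_apply]; split_ifs <;> simp
    · unfold charPoint
      split_ifs with hi
      · rcases Finset.mem_union.1 hi with hi | hi
        · exact (eq_one_of_mem_convexHull_mixedFace hz hi).ge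
        · exact (eq_one_of_mem_convexHull_mixedFace hz' hi).ge
      · exact hP0 z hzP i
  · rfl

/-- The slack of the inequality `∑ a i * x i ≤ b` at the column of `Y` indexed by `S|_1`. -/
noncomputable def columnSlack [Fintype ι] (Y : Matrix (faceFamily ι k) (faceFamily ι k) ℝ)
    (a : ι → ℝ) (b : ℝ) (S : Finset ι) : ℝ :=
  b * liftEntry Y (mixedFace ∅ ∅) (mixedFace S ∅)
    - ∑ i, a i * liftEntry Y (mixedFace {i} ∅) (mixedFace S ∅)

theorem mixedFace_right_empty_mem_faceFamily {S : Finset ι} (hS : S.card ≤ k) :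
    mixedFace S ∅ ∈ faceFamily ι k :=
  mixedFace_mem_faceFamily (by simp) (by simpa using hS)

theorem IsSAPlusPrimeLift.columnSlack_eq_zero [Fintype ι] (hY : IsSAPlusPrimeLift hk P Y)
    (hP0 : ∀ x ∈ P, 0 ≤ x) (hdown : ∀ x ∈ P, ∀ y : ι → ℝ, 0 ≤ y → y ≤ x → y ∈ P)
    (a : ι → ℝ) (b : ℝ) {S : Finset ι} (hS : charPoint S ∉ P) : columnSlack Y a b S = 0 := by
  classical
  have h : ∀ U : Finset ι, liftEntry Y (mixedFace U ∅) (mixedFace S ∅) = 0 := by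
    refine fun U => hY.liftEntry_eq_zero hP0 hdown fun hU => hS (hdown _ hU _ (fun i => ?_)
      fun i => ?_)
    · unfold charPoint; simp only [Pi.zero_apply]; split_ifs <;> simp
    · by_cases hi : i ∈ S <;> by_cases hi' : i ∈ U <;> simp [charPoint, hi, hi']
  simp [columnSlack, h]

/-- Evaluate the quadratic form of `Y` with weight `b` on `S|_1` and `-a i` on `(S ∪ {i})|_1`.
Entries depend only on intersections, so each row sums to the slack of its own index set. -/
theorem IsSAPlusLift.columnSlack_psd [Fintype ι] [DecidableEq ι] (hY : IsSAPlusLift hk P Y)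
    (a : ι → ℝ) (b : ℝ) {S : Finset ι} (hS : S.card + 1 ≤ k) :
    ∑ i, a i * columnSlack Y a b (insert i S) ≤ b * columnSlack Y a b S := by
  have hins : ∀ i, (insert i S).card ≤ k := fun i => (Finset.card_insert_le i S).trans hS
  have hmem : ∀ {U : Finset ι}, U.card ≤ k → mixedFace U ∅ ∈ faceFamily ι k :=
    fun h => mixedFace_right_empty_mem_faceFamily h
  have hSk : S.card ≤ k := by omega
  have h0 : (∅ : Finset ι).card ≤ k := by simp
  have h1 : ∀ i : ι, ({i} : Finset ι).card ≤ k := fun i => by simpa using hk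
  -- Indexing by `Option ι` allows repeated rows: `insert i S = S` when `i ∈ S`.
  have hpsd := (hY.posSemidef.submatrix (fun o : Option ι =>
    o.elim (⟨mixedFace S ∅, hmem hSk⟩ : faceFamily ι k)
      fun i => ⟨mixedFace (insert i S) ∅, hmem (hins i)⟩)).dotProduct_mulVec_nonneg
      (fun o => o.elim b fun i => - a i)
  simp only [dotProduct, Matrix.mulVec, Fintype.sum_option, Matrix.submatrix_apply,
    Pi.star_apply, star_trivial, Option.elim] at hpsd
  simp only [← liftEntry_of_mem Y] at hpsd
  have e0 : liftEntry Y (mixedFace S ∅) (mixedFace S ∅)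
      = liftEntry Y (mixedFace ∅ ∅) (mixedFace S ∅) :=
    hY.liftEntry_congr (hmem hSk) (hmem hSk) (hmem h0) (hmem hSk) (by simp [mixedFace_inter])
  have e1 : ∀ i, liftEntry Y (mixedFace S ∅) (mixedFace (insert i S) ∅)
      = liftEntry Y (mixedFace {i} ∅) (mixedFace S ∅) := fun i =>
    hY.liftEntry_congr (hmem hSk) (hmem (hins i)) (hmem (h1 i)) (hmem hSk)
      (by simp only [mixedFace_inter]; congr 1; ext; simp)
  have e2 : ∀ i, liftEntry Y (mixedFace (insert i S) ∅) (mixedFace S ∅)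
      = liftEntry Y (mixedFace ∅ ∅) (mixedFace (insert i S) ∅) := fun i =>
    hY.liftEntry_congr (hmem (hins i)) (hmem hSk) (hmem h0) (hmem (hins i))
      (by simp only [mixedFace_inter]; congr 1; ext; simp)
  have e3 : ∀ i j, liftEntry Y (mixedFace (insert i S) ∅) (mixedFace (insert j S) ∅)
      = liftEntry Y (mixedFace {j} ∅) (mixedFace (insert i S) ∅) := fun i j =>
    hY.liftEntry_congr (hmem (hins i)) (hmem (hins j)) (hmem (h1 j)) (hmem (hins i))
      (by simp only [mixedFace_inter]; congr 1; ext; simp; tauto)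
  simp only [e0, e1, e2, e3] at hpsd
  have hf : ∀ U, liftEntry Y (mixedFace ∅ ∅) (mixedFace U ∅) * b
      + ∑ i, liftEntry Y (mixedFace {i} ∅) (mixedFace U ∅) * -a i = columnSlack Y a b U := by
    intro U
    rw [columnSlack, sub_eq_add_neg, ← Finset.sum_neg_distrib, mul_comm]
    congr 1
    exact Finset.sum_congr rfl fun i _ => by ring
  simp only [hf] at hpsd
  simp only [neg_mul, Finset.sum_neg_distrib] at hpsd
  linarith

/-- Splitting over which `N ⊆ R` is set to `1` gives the slack as `∑ w N * (b - a(S ∪ N))`. The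
weights are nonnegative and vanish when `S ∪ N` is infeasible; otherwise the bracket is positive. -/
theorem IsSAPlusPrimeLift.columnSlack_nonneg_of_extensions [Fintype ι] [DecidableEq ι]
    (hY : IsSAPlusPrimeLift hk P Y) (hP0 : ∀ x ∈ P, 0 ≤ x)
    (hdown : ∀ x ∈ P, ∀ y : ι → ℝ, 0 ≤ y → y ≤ x → y ∈ P) {a : ι → ℝ} {b : ℝ}
    (hab : ∀ M : Finset ι, charPoint M ∈ P → ∑ i ∈ M, a i < b) {S R : Finset ι}
    (hS : S.card ≤ k) (hR : R.card ≤ k)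
    (hSR : ∀ i, i ∉ S → (i ∈ R ↔ charPoint (S ∪ {i}) ∈ P)) :
    0 ≤ columnSlack Y a b S := by
  have hmem : ∀ {U : Finset ι}, U.card ≤ k → mixedFace U ∅ ∈ faceFamily ι k :=
    fun h => mixedFace_right_empty_mem_faceFamily h
  have h0 : (∅ : Finset ι).card ≤ k := by simp
  have h1 : ∀ i : ι, ({i} : Finset ι).card ≤ k := fun i => by simpa using hk
  set w : Finset ι → ℝ := fun N => liftEntry Y (mixedFace S ∅) (mixedFace N (R \ N)) with hw
  have hsymm : ∀ U : Finset ι, U.card ≤ k → liftEntry Y (mixedFace U ∅) (mixedFace S ∅)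
      = liftEntry Y (mixedFace S ∅) (mixedFace U ∅) := fun U hU =>
    hY.liftEntry_congr (hmem hU) (hmem hS) (hmem hS) (hmem hU) (Set.inter_comm _ _)
  have htot : liftEntry Y (mixedFace ∅ ∅) (mixedFace S ∅) = ∑ N ∈ R.powerset, w N := by
    rw [hsymm _ h0, hY.liftEntry_partition (hmem hS) R ∅ ∅ (by simp) (by simp) (by simpa using hR)]
    simp [hw]
  have hcoord : ∀ i, liftEntry Y (mixedFace {i} ∅) (mixedFace S ∅)
      = ∑ N ∈ R.powerset, if i ∈ S ∪ N then w N else 0 := by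
    intro i
    by_cases hiS : i ∈ S
    · have : liftEntry Y (mixedFace {i} ∅) (mixedFace S ∅)
          = liftEntry Y (mixedFace ∅ ∅) (mixedFace S ∅) :=
        hY.liftEntry_congr (hmem (h1 i)) (hmem hS) (hmem h0) (hmem hS)
          (by simp only [mixedFace_inter]; congr 1; ext; simp; rintro rfl; exact hiS)
      rw [this, htot]
      simp [hiS]
    by_cases hiR : i ∈ R
    -- With `i` already fixed to `1`, only `R \ {i}` is split, so the total size stays `|R| ≤ k`.
    · obtain ⟨R', hiR', rfl⟩ : ∃ R', i ∉ R' ∧ insert i R' = R :=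
        ⟨R.erase i, by simp, Finset.insert_erase hiR⟩
      rw [Finset.card_insert_of_notMem hiR'] at hR
      rw [hsymm _ (h1 i), hY.liftEntry_partition (hmem hS) R' {i} ∅ (by simp) (by simpa using hiR')
        (by simp; omega), Finset.sum_powerset_insert hiR']
      rw [Finset.sum_eq_zero (s := R'.powerset) (f := fun N => if i ∈ S ∪ N then w N else 0),
        zero_add]
      · refine Finset.sum_congr rfl fun N hN => ?_
        rw [if_pos (by simp), hw]
        simp only
        rw [Finset.insert_sdiff_insert, Finset.sdiff_insert_of_notMem hiR', Finset.empty_union,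
          Finset.insert_eq]
      · intro N hN
        refine if_neg fun h => ?_
        exact (Finset.mem_union.1 h).elim hiS fun h => hiR' (Finset.mem_powerset.1 hN h)
    -- Here `i` cannot extend `S`, so both sides are zero.
    · rw [hsymm _ (h1 i), hY.liftEntry_eq_zero hP0 hdown (fun h => hiR ((hSR i hiS).2 h))]
      refine (Finset.sum_eq_zero fun N hN => if_neg fun h => ?_).symm
      exact (Finset.mem_union.1 h).elim hiS fun h => hiR (Finset.mem_powerset.1 hN h)
  have : columnSlack Y a b S = ∑ N ∈ R.powerset, w N * (b - ∑ i ∈ S ∪ N, a i) := by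
    simp only [columnSlack, htot, hcoord, mul_sub, Finset.sum_sub_distrib, Finset.mul_sum]
    congr 1
    · exact Finset.sum_congr rfl fun N _ => mul_comm _ _
    · rw [Finset.sum_comm]
      refine Finset.sum_congr rfl fun N _ => ?_
      simp only [mul_ite, mul_zero, Finset.sum_ite_mem, Finset.univ_inter]
      exact Finset.sum_congr rfl fun i _ => mul_comm _ _
  rw [this]
  refine Finset.sum_nonneg fun N _ => ?_
  by_cases hN : charPoint (S ∪ N) ∈ P
  · exact mul_nonneg (hY.liftEntry_nonneg _ _) (sub_nonneg.2 (hab _ hN).le)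
  · rw [show w N = 0 from hY.liftEntry_eq_zero hP0 hdown hN, zero_mul]

/-- Downward induction on `|S| = k - m`. In `columnSlack_psd` the terms with `i ∈ S` reproduce the
slack of `S` and the others are nonnegative by induction, leaving `(b - a(S)) * s(S) ≥ 0`; the
strict bound `a(S) < b` lets the factor be cancelled. -/
theorem IsSAPlusPrimeLift.columnSlack_nonneg [Fintype ι] [DecidableEq ι]
    (hY : IsSAPlusPrimeLift hk P Y) (hP0 : ∀ x ∈ P, 0 ≤ x)
    (hdown : ∀ x ∈ P, ∀ y : ι → ℝ, 0 ≤ y → y ≤ x → y ∈ P)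
    (hext : ∀ S : Finset ι, S.card = k → charPoint S ∈ P →
      {i | i ∉ S ∧ charPoint (S ∪ {i}) ∈ P}.ncard ≤ k)
    {a : ι → ℝ} {b : ℝ} (ha : 0 ≤ a)
    (hab : ∀ M : Finset ι, charPoint M ∈ P → ∑ i ∈ M, a i < b) (m : ℕ) :
    ∀ S : Finset ι, S.card + m = k → 0 ≤ columnSlack Y a b S := by
  classical
  induction m with
  | zero =>
    intro S hS
    by_cases hSP : charPoint S ∈ P
    · have hR := hext S hS hSP
      rw [Set.ncard_eq_toFinset_card'] at hR
      refine hY.columnSlack_nonneg_of_extensions hP0 hdown hab hS.le hR fun i hi => ?_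
      simp [hi]
    · exact (hY.columnSlack_eq_zero hP0 hdown a b hSP).ge
  | succ m ih =>
    intro S hS
    by_cases hSP : charPoint S ∈ P
    · have hpsd := hY.columnSlack_psd a b (S := S) (by omega)
      have hle : (∑ i ∈ S, a i) * columnSlack Y a b S
          ≤ ∑ i, a i * columnSlack Y a b (insert i S) := by
        rw [Finset.sum_mul]
        calc ∑ i ∈ S, a i * columnSlack Y a b S
            = ∑ i ∈ S, a i * columnSlack Y a b (insert i S) :=
              Finset.sum_congr rfl fun i hi => by rw [Finset.insert_eq_of_mem hi]
          _ ≤ _ := Finset.sum_le_sum_of_subset_of_nonneg (Finset.subset_univ _) fun i _ hi =>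
              mul_nonneg (ha i) (ih _ (by rw [Finset.card_insert_of_notMem hi]; omega))
      refine nonneg_of_mul_nonneg_right (a := b - ∑ i ∈ S, a i) ?_ (sub_pos.2 (hab S hSP))
      linarith
    · exact (hY.columnSlack_eq_zero hP0 hdown a b hSP).ge

/-- `SA'_+^k` is exact on a down-closed polytope if every 0-1 point with support of size `k`
has at most `k` one-element extensions in the polytope. -/
theorem saPlusPrime_eq_integerHull [Fintype ι] [DecidableEq ι] (hconv : Convex ℝ P)
    (hP0 : ∀ x ∈ P, 0 ≤ x) (hdown : ∀ x ∈ P, ∀ y : ι → ℝ, 0 ≤ y → y ≤ x → y ∈ P) (hk : 1 ≤ k)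
    (hext : ∀ S : Finset ι, S.card = k → charPoint S ∈ P →
      {i | i ∉ S ∧ charPoint (S ∪ {i}) ∈ P}.ncard ≤ k) :
    saPlusPrime k P = integerHull P := by
  refine (Set.Subset.antisymm ?_ (integerHull_subset_saPlusPrime hconv hk))
  rintro x (⟨rfl, -⟩ | ⟨_, Y, hY, hx⟩)
  · omega
  by_contra hxP
  have hentry : ∀ i, liftEntry Y (mixedFace {i} ∅) (mixedFace ∅ ∅) = x i := by
    intro i
    rw [mixedFace_singleton, mixedFace_empty, liftEntry_of_mem Y
      (cubeFace_singleton_mem_faceFamily hk i) (cubePoints_mem_faceFamily ι k)]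
    exact congrFun (congrArg Prod.snd hx) i
  have hunit : liftEntry Y (mixedFace ∅ ∅) (mixedFace ∅ ∅) = 1 := by
    rw [mixedFace_empty, liftEntry_of_mem Y
      (cubePoints_mem_faceFamily ι k) (cubePoints_mem_faceFamily ι k)]
    exact hY.unit_entry
  have hx0 : 0 ≤ x := fun i => (hentry i).symm ▸ hY.liftEntry_nonneg _ _
  obtain ⟨a, b, ha, hbx, hab⟩ := exists_nonneg_separation hdown hx0 hxP
  have h := hY.columnSlack_nonneg hP0 hdown hext ha hab k ∅ (by simp)
  simp only [columnSlack, hentry, hunit, mul_one] at h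
  linarith

end Exactness

/-! ### Matchings and their extensions -/

section Matching

variable {V : Type*} [Fintype V] [DecidableEq V] (G : SimpleGraph V) [DecidableRel G.Adj]

theorem convex_matchingRelaxation : Convex ℝ (matchingRelaxation G) := by
  intro x hx y hy a b ha hb hab
  refine ⟨fun e => ⟨?_, ?_⟩, fun v => ?_⟩
  · exact add_nonneg (mul_nonneg ha (hx.1 e).1) (mul_nonneg hb (hy.1 e).1)
  · simp only [Pi.add_apply, Pi.smul_apply, smul_eq_mul]
    nlinarith [mul_le_mul_of_nonneg_left (hx.1 e).2 ha, mul_le_mul_of_nonneg_left (hy.1 e).2 hb]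
  · simp only [Pi.add_apply, Pi.smul_apply, smul_eq_mul, Finset.sum_add_distrib, ← Finset.mul_sum]
    nlinarith [mul_le_mul_of_nonneg_left (hx.2 v) ha, mul_le_mul_of_nonneg_left (hy.2 v) hb]

theorem matchingRelaxation_nonneg {x : G.edgeSet → ℝ} (hx : x ∈ matchingRelaxation G) : 0 ≤ x :=
  fun e => (hx.1 e).1

theorem matchingRelaxation_of_le {x y : G.edgeSet → ℝ} (hx : x ∈ matchingRelaxation G)
    (hy : 0 ≤ y) (hyx : y ≤ x) : y ∈ matchingRelaxation G :=
  ⟨fun e => ⟨hy e, (hyx e).trans (hx.1 e).2⟩,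
    fun v => (Finset.sum_le_sum fun e _ => hyx e).trans (hx.2 v)⟩

variable {G}

theorem eq_of_charPoint_mem_matchingRelaxation {S : Finset G.edgeSet}
    (hS : charPoint S ∈ matchingRelaxation G) {e f : G.edgeSet} (he : e ∈ S) (hf : f ∈ S) {v : V}
    (hve : v ∈ (e : Sym2 V)) (hvf : v ∈ (f : Sym2 V)) : e = f := by
  classical
  by_contra hne
  have h := hS.2 v
  have hsub : ({e, f} : Finset G.edgeSet)
      ⊆ Finset.univ.filter (fun e : G.edgeSet => v ∈ (e : Sym2 V)) := by
    intro d hd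
    rcases Finset.mem_insert.1 hd with rfl | hd
    · simpa using hve
    · rw [Finset.mem_singleton.1 hd]; simpa using hvf
  have h2 := Finset.sum_le_sum_of_subset_of_nonneg (f := charPoint S) hsub
    fun d _ _ => (hS.1 d).1
  rw [Finset.sum_pair hne] at h2
  simp only [charPoint, he, hf, if_true] at h2
  unfold charPoint at h
  linarith

theorem card_biUnion_toFinset_of_matching {S : Finset G.edgeSet}
    (hS : charPoint S ∈ matchingRelaxation G) :
    (S.biUnion fun e => (e : Sym2 V).toFinset).card = 2 * S.card := by
  rw [Finset.card_biUnion, Finset.sum_congr rfl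
    (fun e _ => Sym2.card_toFinset_of_not_isDiag _ (G.not_isDiag_of_mem_edgeSet e.2))]
  · simp [mul_comm]
  · intro e he f hf hne
    refine Finset.disjoint_left.2 fun v hv hv' => hne ?_
    exact eq_of_charPoint_mem_matchingRelaxation hS he hf (Sym2.mem_toFinset.1 hv)
      (Sym2.mem_toFinset.1 hv')

/-- An extending edge avoids the `2|S|` vertices covered by `S`, so it is a pair of uncovered
vertices. -/
theorem ncard_extensions_le {S : Finset G.edgeSet} (hS : charPoint S ∈ matchingRelaxation G) :
    {e | e ∉ S ∧ charPoint (S ∪ {e}) ∈ matchingRelaxation G}.ncard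
      ≤ (Fintype.card V - 2 * S.card).choose 2 := by
  rw [← card_biUnion_toFinset_of_matching hS, ← Finset.card_compl, ← Sym2.card_image_offDiag,
    ← Set.ncard_coe_finset]
  refine Set.ncard_le_ncard_of_injOn (fun e : G.edgeSet => (e : Sym2 V)) ?_
    Subtype.val_injective.injOn (Finset.finite_toSet _)
  rintro ⟨e, heG⟩ ⟨heS, he⟩
  have hout : ∀ v ∈ e, v ∉ S.biUnion fun e => (e : Sym2 V).toFinset := by
    intro v hv hvS
    obtain ⟨f, hf, hvf⟩ := Finset.mem_biUnion.1 hvS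
    have := eq_of_charPoint_mem_matchingRelaxation he (e := ⟨e, heG⟩) (f := f)
      (by simp) (by simp [hf]) hv (Sym2.mem_toFinset.1 hvf)
    exact heS (this ▸ hf)
  induction e using Sym2.ind with
  | _ u v =>
    simp only [Finset.coe_image, Set.mem_image, Finset.mem_coe, Finset.mem_offDiag]
    refine ⟨(u, v), ⟨?_, ?_, G.ne_of_adj heG⟩, rfl⟩
    · exact Finset.mem_compl.2 (hout u (by simp))
    · exact Finset.mem_compl.2 (hout v (by simp))

end Matching

/-! ### The complete graph and the rank bound -/

theorem integerHull_eq_self_of_isEmpty {ι : Type*} [IsEmpty ι] (P : Set (ι → ℝ)) :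
    integerHull P = P := by
  have : P ∩ cubePoints ι = P := Set.inter_eq_left.2 fun x _ i => isEmptyElim i
  rw [integerHull, this]
  exact Set.Subsingleton.convex (Set.subsingleton_of_subsingleton) |>.convexHull_eq

theorem saPlusPrime_zero {ι : Type*} (P : Set (ι → ℝ)) : saPlusPrime 0 P = P := by
  ext x; simp [saPlusPrime]

theorem saPlusPrime_matchingRelaxation_top {n g : ℕ} (hg : 2 * g * g + 2 * g ≤ n) :
    saPlusPrime (n - g) (matchingRelaxation (⊤ : SimpleGraph (Fin (2 * n + 1))))
      = integerHull (matchingRelaxation (⊤ : SimpleGraph (Fin (2 * n + 1)))) := by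
  have hgn : 2 * g ≤ n := by omega
  -- For `n = 0` the level is `0`, outside the criterion, but there are no edges. For `n > 0`, `2g ≤
  -- n` gives `n - g ≥ 1`.
  rcases Nat.eq_zero_or_pos n with rfl | hn
  · have : IsEmpty (⊤ : SimpleGraph (Fin (2 * 0 + 1))).edgeSet := by
      refine ⟨fun ⟨e, he⟩ => ?_⟩
      induction e using Sym2.ind with
      | _ u v => exact he (Subsingleton.elim (α := Fin 1) u v)
    rw [Nat.zero_sub, saPlusPrime_zero, integerHull_eq_self_of_isEmpty]
  · refine saPlusPrime_eq_integerHull (convex_matchingRelaxation _)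
      (fun x hx => matchingRelaxation_nonneg _ hx)
      (fun x hx y hy hyx => matchingRelaxation_of_le _ hx hy hyx) (by omega) fun S hS hSP => ?_
    refine (ncard_extensions_le hSP).trans ?_
    rw [hS, Fintype.card_fin, show 2 * n + 1 - 2 * (n - g) = 2 * g + 1 by omega,
      Nat.choose_two_right, Nat.add_sub_cancel, mul_left_comm, Nat.mul_div_cancel_left _ two_pos]
    have : (2 * g + 1) * g = 2 * g * g + g := by ring
    omega

theorem theorem13 (n : ℕ) :
    ∃ r : ℕ,
      IsLiftRank saPlusPrime (matchingRelaxation (⊤ : SimpleGraph (Fin (2 * n + 1)))) r ∧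
      (r : ℤ) ≤ (n : ℤ) - ⌊(Real.sqrt (2 * (n : ℝ) + 1) - 1) / 2⌋ := by
  have hsqrt : 1 ≤ Real.sqrt (2 * (n : ℝ) + 1) :=
    Real.one_le_sqrt.2 (by linarith [(Nat.cast_nonneg n : (0 : ℝ) ≤ n)])
  obtain ⟨g, hg⟩ : ∃ g : ℕ, ⌊(Real.sqrt (2 * (n : ℝ) + 1) - 1) / 2⌋ = (g : ℤ) :=
    Int.eq_ofNat_of_zero_le (Int.floor_nonneg.2 (by linarith))
  have hle : (g : ℝ) ≤ (Real.sqrt (2 * (n : ℝ) + 1) - 1) / 2 := by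
    have := Int.floor_le ((Real.sqrt (2 * (n : ℝ) + 1) - 1) / 2)
    rw [hg] at this
    exact_mod_cast this
  have hbound : 2 * g * g + 2 * g ≤ n := by
    -- Squaring `2g + 1 ≤ √(2n+1)` gives `4g² + 4g ≤ 2n`.
    have h := (Real.le_sqrt (by positivity) (by positivity)).1
      (show 2 * (g : ℝ) + 1 ≤ Real.sqrt (2 * (n : ℝ) + 1) by linarith)
    have : (2 * g * g + 2 * g : ℝ) ≤ n := by nlinarith
    exact_mod_cast this
  have hmem := saPlusPrime_matchingRelaxation_top hbound
  have hex : ∃ k, saPlusPrime k (matchingRelaxation (⊤ : SimpleGraph (Fin (2 * n + 1))))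
      = integerHull (matchingRelaxation (⊤ : SimpleGraph (Fin (2 * n + 1)))) := ⟨_, hmem⟩
  refine ⟨Nat.find hex, ⟨Nat.find_spec hex, fun k hk => Nat.find_min' hex hk⟩, ?_⟩
  have := Nat.find_min' hex hmem
  rw [hg]
  omega
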